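/- Let $k$ be a field of characteristic zero, $\theta\in k$, and let $\mathcal D$ be a set. *The Grossman–Larson algebra.* Let $\mathcal T$ be the $k$-linear span of the set of (non-planar, finite, nonempty) rooted trees with vertices decorated by $\mathcal D$; identify $d\in\mathcal D$ with the one-vertex tree decorated by $d$. For a tree $t$ and a forest (commutative product of trees) $G=s_1\cdots s_m$, let $t\curvearrowleft G$ be the sum, over all maps from $\{1,\dots,m\}$ to the set of vertices of $t$, of the trees obtained by joining the root of each $s_j$ by an edge to the vertex assigned to it. Let $GL$ be the span of all forests (i.e. the polynomial algebra on the set of trees) and $GL^+\subset GL$ the span of the nonempty forests, with the commutative product of forests and with the Grossman–Larson product $$(t_1\cdots t_n)\ast(s_1\cdots s_m)=\sum_{f:\{1,\dots,m\}\to\{0,\dots,n\}}F_0\,(t_1\curvearrowleft F_1)\cdots(t_n\curvearrowleft F_n),\qquad F_i=\prod_{j\in f^{-1}(i)}s_j .$$ *The free Rota–Baxter algebra.* Let $(RB,R)$ be the free unital associative (noncommutative) Rota–Baxter algebra of weight $\theta$ over $\mathcal D$, where the Rota–Baxter identity is $R(x)R(y)=R(R(x)y+xR(y))+\theta R(xy)$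 and $R$ is linear. On $RB$ put $$a\triangleleft_\theta b=aR(b)-R(b)a+\theta ab,\qquad a\ast_\theta b=R(a)b+aR(b)+\theta ab .$$ Define $R^{[1}(a_1)=a_1$ and $R^{[n}(a_1,\dots,a_n)=R\bigl(R^{[n-1}(a_1,\dots,a_{n-1})\bigr)a_n$, and write $R^{[n}(b)=R^{[n}(b,\dots,b)$. **Theorem.** There is exactly one linear map $\iota:GL^+\to RB$ (the canonical map) such that $\iota(d)=d$ for every $d\in\mathcal D$, $\iota(x\curvearrowleft y)=\iota(x)\triangleleft_\theta\iota(y)$ for all $x,y\in\mathcal T$, and $\iota(x\ast y)=\iota(x)\ast_\theta\iota(y)$ for all $x,y\in GL^+$. It sends symmetric products of generators to pre-time-ordered products: for all $n\ge 1$ and $b_1,\dots,b_n\in\mathcal D$, $$\iota(b_1\cdots b_n)=\sum_{\sigma\in S_n}R^{[n}(b_{\sigma(1)},\dots,b_{\sigma(n)})=\sum_{\sigma\in S_n}R\bigl(\cdots R(R(b_{\sigma(1)})b_{\sigma(2)})\cdots\bigr)b_{\sigma(n)} .$$ Moreover (the polarized form), for every $n\ge1$ and every $b$ in the $k$-linear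 span of $\mathcal D$, $$\iota(b^n)=n!\,R^{[n}(b).$$ -/

import Mathlib

noncomputable section

/-! ### Decorated rooted trees -/

/-- Planar rooted trees whose vertices are decorated by elements of `D`: a decorated root together
with the list of the subtrees attached to it. -/
inductive PTree (D : Type*) : Type _
  | node : D → List (PTree D) → PTree D

/-- Elementary identifications: permuting the subtrees attached to the root, and replacing one of
the subtrees by an identified one. The equivalence relation they generate forgets the planar
structure. -/
inductive PTree.Rel {D : Type*} : PTree D → PTree D → Prop
  | perm (d : D) {l₁ l₂ : List (PTree D)} : l₁.Perm l₂ → Rel (.node d l₁) (.node d l₂)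
  | congr (d : D) (l₁ l₂ : List (PTree D)) {t t' : PTree D} : Rel t t' →
      Rel (.node d (l₁ ++ t :: l₂)) (.node d (l₁ ++ t' :: l₂))

/-- `D`-decorated (non-planar) rooted trees. -/
def RTree (D : Type*) : Type _ := Quot (PTree.Rel (D := D))

namespace RTree

variable {D : Type*}

/-- The rooted tree underlying a planar one. -/
def mk (t : PTree D) : RTree D := Quot.mk _ t

/-- A planar representative of a tree. -/
def out (t : RTree D) : PTree D := Quot.out t

/-- `node d F` is the tree whose root is decorated by `d` and whose root has the trees of the
forest `F` as subtrees. Representatives are chosen, and the choice is irrelevant (`node_mk`). -/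
def node (d : D) (F : Multiset (RTree D)) : RTree D :=
  mk (.node d (F.toList.map RTree.out))

theorem mk_out (t : RTree D) : mk (out t) = t := Quot.out_eq t

theorem mk_node_congr (d : D) (l₁ l₂ : List (PTree D)) {t t' : PTree D} (h : mk t = mk t') :
    mk (.node d (l₁ ++ t :: l₂)) = mk (.node d (l₁ ++ t' :: l₂)) := by
  let f : RTree D → RTree D := Quot.lift (fun s => mk (.node d (l₁ ++ s :: l₂)))
    (fun _ _ h => Quot.sound (PTree.Rel.congr d l₁ l₂ h))
  exact congrArg f h

theorem mk_node_map (d : D) (f : PTree D → PTree D) (hf : ∀ t, mk (f t) = mk t)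
    (l₁ l₂ : List (PTree D)) :
    mk (.node d (l₁ ++ l₂.map f)) = mk (.node d (l₁ ++ l₂)) := by
  induction l₂ generalizing l₁ with
  | nil => rfl
  | cons t l ih =>
    rw [List.map_cons, mk_node_congr d l₁ (l.map f) (hf t)]
    simpa using ih (l₁ ++ [t])

theorem node_mk (d : D) (l : List (PTree D)) :
    node d (l.map mk : List (RTree D)) = mk (.node d l) := by
  have h : ((l.map mk : List (RTree D)) : Multiset (RTree D)).toList.Perm (l.map mk) := by
    rw [← Multiset.coe_eq_coe, Multiset.coe_toList]
  have h2 : (((l.map mk : List (RTree D)) : Multiset (RTree D)).toList.map RTree.out).Perm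
      (l.map fun t => RTree.out (mk t)) := by
    have := h.map RTree.out
    rwa [List.map_map] at this
  have h3 : node d (l.map mk : List (RTree D)) = mk (.node d (l.map fun t => RTree.out (mk t))) :=
    Quot.sound (PTree.Rel.perm d h2)
  rw [h3]
  exact mk_node_map d _ (fun t => mk_out _) [] l

/-- The tree with a single vertex, decorated by `d`. -/
def leaf (d : D) : RTree D := node d 0

end RTree

/-! ### The Grossman--Larson algebra -/

/-- The linear span of the set of decorated rooted trees. -/
abbrev TreeSpan (k D : Type*) [Field k] := RTree D →₀ k

/-- The linear span of all forests, where forests are finite multisets of trees and the empty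
forest is the unit. Its multiplication `*` as an algebra is the commutative product of forests, so
that `GrossmanLarson k D` is the polynomial algebra over the set of trees. -/
abbrev GrossmanLarson (k D : Type*) [Field k] := AddMonoidAlgebra k (Multiset (RTree D))

namespace GrossmanLarson

variable (k : Type*) {D : Type*} [Field k]

/-- A forest as an element of `GL`. -/
def forest (F : Multiset (RTree D)) : GrossmanLarson k D := AddMonoidAlgebra.single F 1

/-- Linear extension of a map defined on forests. -/
def extend {V : Type*} [AddCommGroup V] [Module k V] (f : Multiset (RTree D) → V) :
    GrossmanLarson k D →ₗ[k] V :=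
  Finsupp.linearCombination k f ∘ₗ (AddMonoidAlgebra.coeffLinearEquiv k).toLinearMap

variable {k} in
@[simp] theorem extend_forest {V : Type*} [AddCommGroup V] [Module k V]
    (f : Multiset (RTree D) → V) (F : Multiset (RTree D)) : extend k f (forest k F) = f F := by
  simp [extend, forest]

/-- The inclusion of the span of trees into `GL`, a tree being a forest with one tree. -/
def ofTrees : TreeSpan k D →ₗ[k] GrossmanLarson k D :=
  Finsupp.linearCombination k fun t => forest k {t}

/-- The linear operator sending a forest `F` to the tree `RTree.node d F`. -/
def bPlus (d : D) : GrossmanLarson k D →ₗ[k] TreeSpan k D :=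
  extend k fun F => Finsupp.single (RTree.node d F) 1

mutual
/-- The action `t ↶ G` of a forest `G` on a (planar) tree `t`: the sum, over all ways to attach
each of the trees of `G` by its root to some vertex of `t`, of the resulting trees. -/
def actAux : PTree D → Multiset (RTree D) → TreeSpan k D
  | .node d l, G => bPlus k d (starAux l G)
/-- The sum, over all ways to distribute the trees of the forest `G` into a forest `G₀` and
forests `Gᵢ`, one for each tree `tᵢ` of the list, of the forests `G₀ (t₁ ↶ G₁) ⋯ (tₙ ↶ Gₙ)`. -/
def starAux : List (PTree D) → Multiset (RTree D) → GrossmanLarson k D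
  | [], G => forest k G
  | t :: l, G => (G.antidiagonal.map fun p => ofTrees k (actAux t p.1) * starAux l p.2).sum
end

theorem antidiagonal_sum_left_comm {α M : Type*} [AddCommMonoid M]
    (f : Multiset α → Multiset α → Multiset α → M) (s : Multiset α) :
    (s.antidiagonal.map fun p => (p.2.antidiagonal.map fun q => f p.1 q.1 q.2).sum).sum =
    (s.antidiagonal.map fun p => (p.2.antidiagonal.map fun q => f q.1 p.1 q.2).sum).sum := by
  induction s using Multiset.induction_on generalizing f with
  | empty => simp
  | cons a s ih =>
    simp only [Multiset.antidiagonal_cons, Multiset.map_add, Multiset.sum_add, Multiset.map_map,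
      Function.comp_def, Prod.map_fst, Prod.map_snd, id, Multiset.sum_map_add]
    rw [ih fun x y z => f x y (a ::ₘ z), ih fun x y z => f x (a ::ₘ y) z,
      ih fun x y z => f (a ::ₘ x) y z]
    abel

theorem starAux_perm {l₁ l₂ : List (PTree D)} (h : l₁.Perm l₂) : starAux k l₁ = starAux k l₂ := by
  induction h with
  | nil => rfl
  | cons t _ ih => funext G; simp only [starAux, ih]
  | swap t t' l =>
    funext G
    simp only [starAux, ← Multiset.sum_map_mul_left]
    rw [antidiagonal_sum_left_comm fun x y z =>
      ofTrees k (actAux k t' x) * (ofTrees k (actAux k t y) * starAux k l z)]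
    simp only [mul_left_comm]
  | trans _ _ h₁ h₂ => exact h₁.trans h₂

theorem starAux_congr (l₁ l₂ : List (PTree D)) {t t' : PTree D} (h : actAux k t = actAux k t') :
    starAux k (l₁ ++ t :: l₂) = starAux k (l₁ ++ t' :: l₂) := by
  induction l₁ with
  | nil => funext G; simp only [List.nil_append, starAux, h]
  | cons s l ih => funext G; simp only [List.cons_append, starAux, ih]

theorem actAux_rel {t t' : PTree D} (h : PTree.Rel t t') : actAux k t = actAux k t' := by
  induction h with
  | perm d h => funext G; simp only [actAux, starAux_perm k h]
  | congr d l₁ l₂ _ ih => funext G; simp only [actAux, starAux_congr k l₁ l₂ ih]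

/-- The action `t ↶ G` of a forest `G` on a tree `t`. -/
def act : RTree D → Multiset (RTree D) → TreeSpan k D :=
  Quot.lift (actAux k) fun _ _ h => actAux_rel k h

/-- The Grossman--Larson product of two forests:
`(t₁ ⋯ tₙ) ∗ G = ∑ G₀ (t₁ ↶ G₁) ⋯ (tₙ ↶ Gₙ)`, the sum being over all ways to distribute the trees of
`G` into `n + 1` forests `G₀, …, Gₙ`. It is computed by `starForest_zero` and `starForest_cons`. -/
def starForest (F G : Multiset (RTree D)) : GrossmanLarson k D := starAux k (F.toList.map RTree.out) G

theorem starForest_coe (l : List (RTree D)) (G : Multiset (RTree D)) :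
    starForest k (l : Multiset (RTree D)) G = starAux k (l.map RTree.out) G := by
  have h : (l : Multiset (RTree D)).toList.Perm l := by
    rw [← Multiset.coe_eq_coe, Multiset.coe_toList]
  rw [starForest, starAux_perm k (h.map RTree.out)]

theorem starForest_zero (G : Multiset (RTree D)) : starForest k 0 G = forest k G := by
  have := starForest_coe k [] G
  rwa [List.map_nil, starAux] at this

theorem starForest_cons (t : RTree D) (F G : Multiset (RTree D)) :
    starForest k (t ::ₘ F) G =
      (G.antidiagonal.map fun p => ofTrees k (act k t p.1) * starForest k F p.2).sum := by
  induction F using Quotient.inductionOn with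
  | h l =>
    have h : actAux k (RTree.out t) = act k t := by
      conv_rhs => rw [← RTree.mk_out t]
      rfl
    change starForest k ((t :: l : List (RTree D)) : Multiset (RTree D)) G =
      (G.antidiagonal.map fun p =>
        ofTrees k (act k t p.1) * starForest k (l : Multiset (RTree D)) p.2).sum
    simp_rw [starForest_coe]
    rw [List.map_cons, starAux, h]

/-- Attaching the trees of `G` to the vertices of a tree amounts to distributing them between the
root and the subtrees of the root. -/
theorem act_node (d : D) (F G : Multiset (RTree D)) :
    act k (RTree.node d F) G = bPlus k d (starForest k F G) := by
  simp only [RTree.node, RTree.mk, act, starForest, actAux]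

/-- Grafting of trees, extended bilinearly: `t ↶ t'` is the sum of all the trees obtained by
creating an edge between the root of `t'` and a vertex of `t`. -/
def graft : TreeSpan k D →ₗ[k] TreeSpan k D →ₗ[k] TreeSpan k D :=
  Finsupp.linearCombination k fun t => Finsupp.linearCombination k fun t' => act k t {t'}

/-- The Grossman--Larson product, extended bilinearly from forests. -/
def star : GrossmanLarson k D →ₗ[k] GrossmanLarson k D →ₗ[k] GrossmanLarson k D :=
  extend k fun F => extend k fun G => starForest k F G

variable (D) in
/-- The subspace `GL⁺` of `GL` spanned by the nonempty forests. -/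
def Plus : Submodule k (GrossmanLarson k D) :=
  Submodule.span k {x | ∃ F : Multiset (RTree D), F ≠ 0 ∧ x = forest k F}

variable {k}

theorem forest_mem_plus {F : Multiset (RTree D)} (hF : F ≠ 0) : forest k F ∈ Plus k D :=
  Submodule.subset_span ⟨F, hF, rfl⟩

theorem forest_mul (F G : Multiset (RTree D)) : forest k F * forest k G = forest k (F + G) := by
  simp [forest, AddMonoidAlgebra.single_mul_single]

theorem mem_span_forest (y : GrossmanLarson k D) : y ∈ Submodule.span k (Set.range (forest k (D := D))) := by
  induction y using AddMonoidAlgebra.induction_linear with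
  | zero => exact zero_mem _
  | add f g hf hg => exact add_mem hf hg
  | single F c =>
    have : (AddMonoidAlgebra.single F c : GrossmanLarson k D) = c • forest k F := by simp [forest]
    rw [this]
    exact Submodule.smul_mem _ _ (Submodule.subset_span ⟨F, rfl⟩)

theorem mul_mem_plus {x : GrossmanLarson k D} (hx : x ∈ Plus k D) (y : GrossmanLarson k D) : x * y ∈ Plus k D := by
  induction hx using Submodule.span_induction with
  | zero => simp
  | add a b _ _ ha hb => rw [add_mul]; exact add_mem ha hb
  | smul c a _ ha => rw [smul_mul_assoc]; exact Submodule.smul_mem _ _ ha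
  | mem x hx =>
    obtain ⟨F, hF, rfl⟩ := hx
    induction mem_span_forest y using Submodule.span_induction with
    | zero => simp
    | add a b _ _ ha hb => rw [mul_add]; exact add_mem ha hb
    | smul c a _ ha => rw [mul_smul_comm]; exact Submodule.smul_mem _ _ ha
    | mem y hy =>
      obtain ⟨G, rfl⟩ := hy
      rw [forest_mul]
      exact forest_mem_plus (by simp [hF])

theorem ofTrees_mem_plus (x : TreeSpan k D) : ofTrees k x ∈ Plus k D := by
  rw [ofTrees, Finsupp.linearCombination_apply]
  exact Submodule.sum_mem _ fun t _ => Submodule.smul_mem _ _ (forest_mem_plus (by simp))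

theorem star_mem_plus {x : GrossmanLarson k D} (hx : x ∈ Plus k D) (y : GrossmanLarson k D) : star k x y ∈ Plus k D := by
  induction hx using Submodule.span_induction with
  | zero => simp
  | add a b _ _ ha hb => rw [map_add]; exact add_mem ha hb
  | smul c a _ ha => rw [map_smul]; exact Submodule.smul_mem _ _ ha
  | mem x hx =>
    obtain ⟨F, hF, rfl⟩ := hx
    induction mem_span_forest y using Submodule.span_induction with
    | zero => simp
    | add a b _ _ ha hb => rw [map_add]; exact add_mem ha hb
    | smul c a _ ha => rw [map_smul]; exact Submodule.smul_mem _ _ ha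
    | mem y hy =>
      obtain ⟨G, rfl⟩ := hy
      obtain ⟨t, ht⟩ := Multiset.exists_mem_of_ne_zero hF
      obtain ⟨F', rfl⟩ := Multiset.exists_cons_of_mem ht
      rw [star, extend_forest, extend_forest, starForest_cons]
      refine Multiset.sum_induction (· ∈ Plus k D) _ (fun _ _ => add_mem) (zero_mem _) ?_
      intro z hz
      obtain ⟨p, _, rfl⟩ := Multiset.mem_map.1 hz
      exact mul_mem_plus (ofTrees_mem_plus _) _

namespace Plus

/-- The inclusion of the span of trees into `GL⁺`. -/
def ofTrees : TreeSpan k D →ₗ[k] Plus k D :=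
  (GrossmanLarson.ofTrees k).codRestrict _ ofTrees_mem_plus

/-- The Grossman--Larson product on `GL⁺`. -/
def star (x y : Plus k D) : Plus k D := ⟨GrossmanLarson.star k x.1 y.1, star_mem_plus x.2 y.1⟩

/-- The symmetric (commutative) product `x₀ x₁ ⋯ xₙ` in `GL⁺` of elements of the span of trees. -/
def symProd {n : ℕ} (x : Fin (n + 1) → TreeSpan k D) : Plus k D :=
  ⟨∏ i, GrossmanLarson.ofTrees k (x i), by
    rw [Fin.prod_univ_succ]; exact mul_mem_plus (ofTrees_mem_plus _) _⟩

end Plus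

end GrossmanLarson

/-! ### Rota--Baxter algebras -/

section RotaBaxter

variable {k A : Type*} [Field k] [Ring A] [Algebra k A]

/-- `R` is a Rota--Baxter operator of weight `θ` on the unital associative algebra `A`. -/
def IsRotaBaxter (θ : k) (R : A →ₗ[k] A) : Prop :=
  ∀ x y : A, R x * R y = R (R x * y + x * R y) + θ • R (x * y)

/-- The right pre-Lie product `a ◁ b = a R(b) - R(b) a + θ a b`. -/
def rbPreLie (θ : k) (R : A →ₗ[k] A) (a b : A) : A := a * R b - R b * a + θ • (a * b)

/-- The double product `a ∗ b = R(a) b + a R(b) + θ a b`. -/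
def rbDouble (θ : k) (R : A →ₗ[k] A) (a b : A) : A := R a * b + a * R b + θ • (a * b)

/-- `rbNested R n (a₀, …, aₙ) = R(⋯ R(R(a₀) a₁) ⋯) aₙ`, where `rbNested R 0 (a₀) = a₀`. -/
def rbNested (R : A →ₗ[k] A) : (n : ℕ) → (Fin (n + 1) → A) → A
  | 0, a => a 0
  | n + 1, a => R (rbNested R n fun i => a i.castSucc) * a (Fin.last (n + 1))

end RotaBaxter

/-! ### The free Rota--Baxter algebra -/

namespace FreeRB

/-- Formal expressions in the generators `D`, the scalars `k`, sums, products and an operator. -/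
inductive Pre (k D : Type*) : Type _
  | of : D → Pre k D
  | scalar : k → Pre k D
  | add : Pre k D → Pre k D → Pre k D
  | mul : Pre k D → Pre k D → Pre k D
  | op : Pre k D → Pre k D

/-- The identities of a unital associative `k`-algebra with a linear operator `op` which is
Rota--Baxter of weight `θ`. The quotient is taken by the congruence they generate. -/
inductive Rel {k : Type*} (D : Type*) [Field k] (θ : k) : Pre k D → Pre k D → Prop
  | add_scalar (r s : k) : Rel D θ (.scalar (r + s)) (.add (.scalar r) (.scalar s))
  | mul_scalar (r s : k) : Rel D θ (.scalar (r * s)) (.mul (.scalar r) (.scalar s))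
  | central (r : k) (a) : Rel D θ (.mul (.scalar r) a) (.mul a (.scalar r))
  | add_assoc (a b c) : Rel D θ (.add (.add a b) c) (.add a (.add b c))
  | add_comm (a b) : Rel D θ (.add a b) (.add b a)
  | zero_add (a) : Rel D θ (.add (.scalar 0) a) a
  | mul_assoc (a b c) : Rel D θ (.mul (.mul a b) c) (.mul a (.mul b c))
  | one_mul (a) : Rel D θ (.mul (.scalar 1) a) a
  | mul_one (a) : Rel D θ (.mul a (.scalar 1)) a
  | left_distrib (a b c) : Rel D θ (.mul a (.add b c)) (.add (.mul a b) (.mul a c))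
  | right_distrib (a b c) : Rel D θ (.mul (.add a b) c) (.add (.mul a c) (.mul b c))
  | zero_mul (a) : Rel D θ (.mul (.scalar 0) a) (.scalar 0)
  | mul_zero (a) : Rel D θ (.mul a (.scalar 0)) (.scalar 0)
  | op_add (a b) : Rel D θ (.op (.add a b)) (.add (.op a) (.op b))
  | op_smul (r : k) (a) : Rel D θ (.op (.mul (.scalar r) a)) (.mul (.scalar r) (.op a))
  | rotaBaxter (a b) : Rel D θ (.mul (.op a) (.op b))
      (.add (.op (.add (.mul (.op a) b) (.mul a (.op b)))) (.mul (.scalar θ) (.op (.mul a b))))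
  | add_left {a b} (c) : Rel D θ a b → Rel D θ (.add a c) (.add b c)
  | add_right (c) {a b} : Rel D θ a b → Rel D θ (.add c a) (.add c b)
  | mul_left {a b} (c) : Rel D θ a b → Rel D θ (.mul a c) (.mul b c)
  | mul_right (c) {a b} : Rel D θ a b → Rel D θ (.mul c a) (.mul c b)
  | op_congr {a b} : Rel D θ a b → Rel D θ (.op a) (.op b)

end FreeRB

/-- The free (unital, associative, noncommutative) Rota--Baxter algebra of weight `θ` over the set
`D`. Its universal property is `FreeRB.existsUnique_lift`. -/
def FreeRB {k : Type*} (D : Type*) [Field k] (θ : k) : Type _ := Quot (FreeRB.Rel D θ)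

namespace FreeRB

variable {k : Type*} {D : Type*} [Field k] {θ : k}

variable (θ) in
/-- The element of the free Rota--Baxter algebra given by a formal expression. -/
def mk (a : Pre k D) : FreeRB D θ := Quot.mk _ a

instance : Zero (FreeRB D θ) := ⟨mk θ (.scalar 0)⟩

instance : One (FreeRB D θ) := ⟨mk θ (.scalar 1)⟩

instance : Add (FreeRB D θ) :=
  ⟨Quot.map₂ Pre.add (fun c _ _ h => Rel.add_right c h) fun _ _ c h => Rel.add_left c h⟩

instance : Mul (FreeRB D θ) :=
  ⟨Quot.map₂ Pre.mul (fun c _ _ h => Rel.mul_right c h) fun _ _ c h => Rel.mul_left c h⟩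

instance : Neg (FreeRB D θ) :=
  ⟨Quot.map (Pre.mul (.scalar (-1))) fun _ _ h => Rel.mul_right _ h⟩

instance : Ring (FreeRB D θ) where
  add_assoc := by rintro ⟨a⟩ ⟨b⟩ ⟨c⟩; exact Quot.sound (Rel.add_assoc a b c)
  zero_add := by rintro ⟨a⟩; exact Quot.sound (Rel.zero_add a)
  add_zero := by
    rintro ⟨a⟩
    exact (Quot.sound (Rel.add_comm a (.scalar 0))).trans (Quot.sound (Rel.zero_add a))
  add_comm := by rintro ⟨a⟩ ⟨b⟩; exact Quot.sound (Rel.add_comm a b)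
  mul_assoc := by rintro ⟨a⟩ ⟨b⟩ ⟨c⟩; exact Quot.sound (Rel.mul_assoc a b c)
  one_mul := by rintro ⟨a⟩; exact Quot.sound (Rel.one_mul a)
  mul_one := by rintro ⟨a⟩; exact Quot.sound (Rel.mul_one a)
  left_distrib := by rintro ⟨a⟩ ⟨b⟩ ⟨c⟩; exact Quot.sound (Rel.left_distrib a b c)
  right_distrib := by rintro ⟨a⟩ ⟨b⟩ ⟨c⟩; exact Quot.sound (Rel.right_distrib a b c)
  zero_mul := by rintro ⟨a⟩; exact Quot.sound (Rel.zero_mul a)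
  mul_zero := by rintro ⟨a⟩; exact Quot.sound (Rel.mul_zero a)
  neg_add_cancel := by
    rintro ⟨a⟩
    have h₁ : mk θ (.add (.mul (.scalar (-1)) a) a) =
        mk θ (.add (.mul (.scalar (-1)) a) (.mul (.scalar 1) a)) :=
      congrArg (fun z : FreeRB D θ => mk θ (.mul (.scalar (-1)) a) + z)
        (Quot.sound (Rel.one_mul a)).symm
    have h₂ : mk θ (.mul (.add (.scalar (-1)) (.scalar 1)) a) = mk θ (.mul (.scalar (-1 + 1)) a) :=
      congrArg (fun z : FreeRB D θ => z * mk θ a) (Quot.sound (Rel.add_scalar (-1) 1)).symm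
    have h₃ : mk θ (.mul (.scalar (-1 + 1)) a) = mk θ (.scalar 0) := by
      rw [neg_add_cancel]; exact Quot.sound (Rel.zero_mul a)
    exact h₁.trans ((Quot.sound (Rel.right_distrib _ _ _)).symm.trans (h₂.trans h₃))
  nsmul := nsmulRec
  zsmul := zsmulRec

instance : Algebra k (FreeRB D θ) where
  smul r := Quot.map (Pre.mul (.scalar r)) fun _ _ h => Rel.mul_right _ h
  algebraMap :=
    { toFun := fun r => Quot.mk _ (.scalar r)
      map_one' := rfl
      map_mul' := fun r s => Quot.sound (Rel.mul_scalar r s)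
      map_zero' := rfl
      map_add' := fun r s => Quot.sound (Rel.add_scalar r s) }
  commutes' := by rintro r ⟨a⟩; exact Quot.sound (Rel.central r a)
  smul_def' := by rintro r ⟨a⟩; rfl

/-- The embedding of the generators. -/
def of (d : D) : FreeRB D θ := mk θ (.of d)

variable (D θ) in
/-- The Rota--Baxter operator of the free Rota--Baxter algebra. -/
def op : FreeRB D θ →ₗ[k] FreeRB D θ where
  toFun := Quot.map Pre.op fun _ _ h => Rel.op_congr h
  map_add' := by rintro ⟨a⟩ ⟨b⟩; exact Quot.sound (Rel.op_add a b)
  map_smul' := by rintro r ⟨a⟩; exact Quot.sound (Rel.op_smul r a)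

variable (D θ) in
theorem isRotaBaxter_op : IsRotaBaxter θ (op D θ) := by
  rintro ⟨a⟩ ⟨b⟩
  exact Quot.sound (Rel.rotaBaxter a b)

section Lift

variable {A : Type*} [Ring A] [Algebra k A]

/-- Evaluation of formal expressions in an algebra with an operator. -/
def Pre.eval (R : A →ₗ[k] A) (f : D → A) : Pre k D → A
  | .of d => f d
  | .scalar r => algebraMap k A r
  | .add a b => a.eval R f + b.eval R f
  | .mul a b => a.eval R f * b.eval R f
  | .op a => R (a.eval R f)

theorem eval_eq_of_rel {R : A →ₗ[k] A} (hR : IsRotaBaxter θ R) (f : D → A) {a b : Pre k D}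
    (h : Rel D θ a b) : a.eval R f = b.eval R f := by
  induction h with
  | add_assoc a b c => exact add_assoc _ _ _
  | mul_assoc a b c => exact _root_.mul_assoc _ _ _
  | central r a => exact Algebra.commutes r _
  | add_comm a b => exact add_comm _ _
  | rotaBaxter a b => simpa [Pre.eval, Algebra.smul_def] using hR (a.eval R f) (b.eval R f)
  | op_smul r a => simp [Pre.eval, ← Algebra.smul_def]
  | _ => simp_all [Pre.eval, mul_add, add_mul]

/-- The universal property of the free Rota--Baxter algebra. -/
theorem existsUnique_lift {R : A →ₗ[k] A} (hR : IsRotaBaxter θ R) (f : D → A) :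
    ∃! φ : FreeRB D θ →ₐ[k] A, (∀ d, φ (of d) = f d) ∧ ∀ x, φ (op D θ x) = R (φ x) := by
  refine ⟨{ toFun := Quot.lift (Pre.eval R f) fun _ _ h => eval_eq_of_rel hR f h
            map_one' := map_one (algebraMap k A)
            map_mul' := by rintro ⟨a⟩ ⟨b⟩; rfl
            map_zero' := map_zero (algebraMap k A)
            map_add' := by rintro ⟨a⟩ ⟨b⟩; rfl
            commutes' := fun r => rfl }, ⟨fun d => rfl, by rintro ⟨a⟩; rfl⟩, ?_⟩
  rintro φ ⟨h₁, h₂⟩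
  ext x
  obtain ⟨a⟩ := x
  change φ (mk θ a) = a.eval R f
  induction a with
  | of d => exact h₁ d
  | scalar r => exact φ.commutes r
  | add a b ha hb =>
    rw [Pre.eval, ← ha, ← hb]
    exact map_add φ (mk θ a) (mk θ b)
  | mul a b ha hb =>
    rw [Pre.eval, ← ha, ← hb]
    exact map_mul φ (mk θ a) (mk θ b)
  | op a ha =>
    rw [Pre.eval, ← ha]
    exact h₂ (mk θ a)

end Lift

end FreeRB

/-! ### The canonical map -/

/-- A linear map `ι` from `GL⁺` to the free Rota--Baxter algebra of weight `θ` is the canonical map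
if it extends the embedding of the generators and sends the grafting product of trees and the
Grossman--Larson product to the pre-Lie product `◁` and to the double product of the free
Rota--Baxter algebra. -/
structure IsCanonical {k D : Type*} [Field k] (θ : k) (ι : GrossmanLarson.Plus k D →ₗ[k] FreeRB D θ) :
    Prop where
  map_leaf : ∀ d : D,
    ι (GrossmanLarson.Plus.ofTrees (Finsupp.single (RTree.leaf d) 1)) = FreeRB.of d
  map_graft : ∀ x y : TreeSpan k D,
    ι (GrossmanLarson.Plus.ofTrees (GrossmanLarson.graft k x y)) =
      rbPreLie θ (FreeRB.op D θ) (ι (GrossmanLarson.Plus.ofTrees x)) (ι (GrossmanLarson.Plus.ofTrees y))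
  map_star : ∀ x y : GrossmanLarson.Plus k D,
    ι (GrossmanLarson.Plus.star x y) = rbDouble θ (FreeRB.op D θ) (ι x) (ι y)

end

noncomputable section

-- Splittings of multisets into two or three parts

namespace Multiset

variable {α β M A : Type*}

-- Everything is a computation with convolution `conv` for the unshuffling coproduct. On multisets
-- in a Rota–Baxter algebra let P = `nested`, L = ε + R∘P (`leftPart`) and M = L + θP (`rightPart`),
-- where ε is the counit. P solves P = L ⋆ `single`: split off the last factor. `brace` solves L ⋆
-- B_a = a·M. Both equations determine their solution recursively. A tree with root d and branches F
-- is sent to B_d of the images of F, a forest to P of the images of its trees.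
--
-- The core is P(F∗G) = L(F)P(G) + P(F)M(G) (`forestHom_starForest`), which on nonempty forests is
-- the double product. By the Rota–Baxter identity it makes L and M multiplicative for ∗
-- (`hom_starForest_of_forestHom`). It rests on the compatibility of ∗ with unshuffling
-- (`convolve_starForest`) and on L ⋆ (t ↶ ·) = t·M for single trees (`isGraftCompatible`), whose
-- value at one tree is the pre-Lie identity. The tree statement follows by induction: t ↶ G is
-- B₊(F∗G), so the brace equation is evaluated at F∗G and L is cancelled by `eq_of_conv_eq`.
--
-- Uniqueness: F∗t is tF plus forests with fewer trees, so leaves generate GL⁺ under grafting and ∗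
-- (`plus_le_of_closed`). The formula for symmetric products iterates P = L ⋆ `single` on a product
-- of primitive elements (`forestHom_prod`).

theorem antidiagonal_map (f : α → β) (s : Multiset α) :
    (s.map f).antidiagonal = s.antidiagonal.map (Prod.map (map f) (map f)) := by
  induction s using Multiset.induction_on with
  | empty => simp
  | cons a s ih =>
    simp only [map_cons, antidiagonal_cons, ih, map_add, map_map]
    congr 1 <;> refine map_congr rfl fun p _ => ?_ <;> simp [Prod.map]

/-- Coassociativity of unshuffling: a new element enters one of three parts, whichever way the
splitting is bracketed. -/
theorem antidiagonal_sum_assoc [AddCommMonoid M]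
    (f : Multiset α → Multiset α → Multiset α → M) (s : Multiset α) :
    (s.antidiagonal.map fun p => (p.1.antidiagonal.map fun q => f q.1 q.2 p.2).sum).sum =
    (s.antidiagonal.map fun p => (p.2.antidiagonal.map fun q => f p.1 q.1 q.2).sum).sum := by
  induction s using Multiset.induction_on generalizing f with
  | empty => simp
  | cons a s ih =>
    simp only [antidiagonal_cons, map_add, sum_add, map_map,
      Function.comp_def, Prod.map_fst, Prod.map_snd, id, sum_map_add]
    rw [ih fun x y z => f x y (a ::ₘ z), ih fun x y z => f x (a ::ₘ y) z,
      ih fun x y z => f (a ::ₘ x) y z]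
    abel

/-! ### Convolution of functions of multisets -/

section Convolution

variable [Ring A]

/-- The convolution product dual to the unshuffling of multisets. -/
def conv (X Y : Multiset α → A) (s : Multiset α) : A :=
  (s.antidiagonal.map fun p => X p.1 * Y p.2).sum

/-- The unit of the convolution product. -/
def counit (s : Multiset α) : A := if s.card = 0 then 1 else 0

@[simp] theorem counit_zero : counit (0 : Multiset α) = (1 : A) := by simp [counit]

@[simp] theorem counit_cons (a : α) (s : Multiset α) : counit (a ::ₘ s) = (0 : A) := by
  simp [counit]

theorem counit_of_ne_zero {s : Multiset α} (hs : s ≠ 0) : counit s = (0 : A) := by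
  simp [counit, hs]

@[simp] theorem counit_map (f : α → β) (s : Multiset α) : counit (s.map f) = (counit s : A) := by
  rw [counit, counit, card_map]

theorem counit_mul_comm (s : Multiset α) (x : A) : counit s * x = x * counit s := by
  unfold counit; split_ifs <;> simp

@[simp] theorem conv_zero (X Y : Multiset α → A) : conv X Y 0 = X 0 * Y 0 := by simp [conv]

/-- The Leibniz rule: a single element is primitive, so it goes to exactly one of the two factors.
-/
theorem conv_cons (X Y : Multiset α → A) (a : α) (s : Multiset α) :
    conv X Y (a ::ₘ s) = conv X (fun u => Y (a ::ₘ u)) s + conv (fun u => X (a ::ₘ u)) Y s := by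
  simp [conv]

theorem conv_counit (X : Multiset α → A) : conv X counit = X := by
  funext s
  induction s using Multiset.induction_on generalizing X with
  | empty => simp
  | cons a s ih =>
    rw [conv_cons, ih]
    simp [conv]

theorem counit_conv (X : Multiset α → A) : conv counit X = X := by
  funext s
  induction s using Multiset.induction_on generalizing X with
  | empty => simp
  | cons a s ih =>
    rw [conv_cons, ih]
    simp [conv]

theorem conv_add_left (X X' Y : Multiset α → A) (s : Multiset α) :
    conv (fun u => X u + X' u) Y s = conv X Y s + conv X' Y s := by
  simp [conv, add_mul]

theorem conv_add_right (X Y Y' : Multiset α → A) (s : Multiset α) :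
    conv X (fun u => Y u + Y' u) s = conv X Y s + conv X Y' s := by
  simp [conv, mul_add]

theorem conv_mul_const (X Y : Multiset α → A) (a : A) (s : Multiset α) :
    conv X (fun u => Y u * a) s = conv X Y s * a := by
  simp only [conv, ← sum_map_mul_right, mul_assoc]

theorem conv_comp_map (X Y : Multiset β → A) (f : α → β) (s : Multiset α) :
    conv X Y (s.map f) = conv (fun u => X (u.map f)) (fun u => Y (u.map f)) s := by
  simp [conv, antidiagonal_map]

/-- The term where the second factor sees all of `s` has coefficient `K 0 = 0`. This makes
convolution equations with such a kernel recursive. -/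
theorem conv_congr_right {K X Y : Multiset α → A} {s : Multiset α} (hK : K 0 = 0)
    (h : ∀ u ≤ s, card u < card s → X u = Y u) : conv K X s = conv K Y s := by
  refine congrArg sum (map_congr rfl fun p hp => ?_)
  rw [mem_antidiagonal] at hp
  rcases eq_or_ne p.1 0 with h0 | h0
  · simp [h0, hK]
  · have : 0 < card p.1 := card_pos.2 h0
    rw [h p.2 (hp ▸ le_add_left _ _) (by rw [← hp, card_add]; omega)]

theorem conv_congr_left {K X Y : Multiset α → A} {s : Multiset α} (hK : K 0 = 0)
    (h : ∀ u ≤ s, card u < card s → X u = Y u) : conv X K s = conv Y K s := by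
  refine congrArg sum (map_congr rfl fun p hp => ?_)
  rw [mem_antidiagonal] at hp
  rcases eq_or_ne p.2 0 with h0 | h0
  · simp [h0, hK]
  · have : 0 < card p.2 := card_pos.2 h0
    rw [h p.1 (hp ▸ le_add_right _ _) (by rw [← hp, card_add]; omega)]

/-- A function of multisets with value `1` at `0` can be cancelled in convolutions. -/
theorem eq_of_conv_eq {W X Y : Multiset α → A} (hW : W 0 = 1) {s : Multiset α}
    (h : ∀ u ≤ s, conv W X u = conv W Y u) : X s = Y s := by
  induction hn : card s using Nat.strong_induction_on generalizing s with
  | _ n ih =>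
    -- Writing `W` as `counit` plus a kernel vanishing at `0` isolates the top term `Z s`.
    have key : ∀ Z : Multiset α → A, conv W Z s = conv (fun u => W u - counit u) Z s + Z s := by
      intro Z
      conv_rhs => rw [← congrFun (counit_conv Z) s]
      rw [← conv_add_left]
      simp
    have h1 := h s le_rfl
    rw [key X, key Y, conv_congr_right (K := fun u => W u - counit u) (X := X) (Y := Y)
      (by simp [hW]) fun u hu hc => ih _ (hn ▸ hc) (fun v hv => h v (hv.trans hu)) rfl] at h1
    exact add_left_cancel h1

/-- An operator on functions of multisets for which the value at `s` only depends on the values at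
smaller multisets has a fixed point. -/
theorem exists_fixedPoint (T : (Multiset α → A) → Multiset α → A)
    (hT : ∀ X Y s, (∀ u, card u < card s → X u = Y u) → T X s = T Y s) : ∃ X, T X = X := by
  -- The iterates stabilize at `s` after `card s + 1` steps, so reading each value there gives the
  -- limit.
  have stable : ∀ n m (s : Multiset α), card s < n → card s < m → T^[n] 0 s = T^[m] 0 s := by
    intro n
    induction n with
    | zero => intro m s h; omega
    | succ n ih =>
      intro m s hn hm
      obtain ⟨m, rfl⟩ : ∃ m', m = m' + 1 := ⟨m - 1, by omega⟩
      rw [Function.iterate_succ_apply', Function.iterate_succ_apply']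
      exact hT _ _ _ fun u hu => ih m u (by omega) (by omega)
  refine ⟨fun s => T^[card s + 1] 0 s, funext fun s => ?_⟩
  rw [Function.iterate_succ_apply']
  exact hT _ _ _ fun u hu => stable _ _ _ (by omega) hu

end Convolution

end Multiset

/-! ### Pre-time-ordered products in a Rota--Baxter algebra -/

namespace RotaBaxter

open Multiset

variable {k A : Type*} [Field k] [Ring A] [Algebra k A]

/-- The element of a multiset with a single element, and `0` for the other multisets. -/
def single (s : Multiset A) : A := if s.card = 1 then s.sum else 0

@[simp] theorem single_zero : single (0 : Multiset A) = 0 := by simp [single]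

@[simp] theorem single_cons (a : A) (s : Multiset A) : single (a ::ₘ s) = a * counit s := by
  by_cases h : s = 0 <;> simp [single, counit, h]

/-- Since `single` vanishes at `0`, the right-hand side at `s` involves `P` only on smaller
multisets. -/
theorem exists_nested (R : A →ₗ[k] A) :
    ∃ P : Multiset A → A, conv (fun u => counit u + R (P u)) single = P :=
  exists_fixedPoint _ fun X Y s h => conv_congr_left single_zero fun u _ hu => by rw [h u hu]

/-- The symmetrized pre-time-ordered product of the elements of a multiset. -/
def nested (R : A →ₗ[k] A) : Multiset A → A := Classical.choose (exists_nested R)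

/-- The unital image of `nested` under the Rota--Baxter operator. -/
def leftPart (R : A →ₗ[k] A) (s : Multiset A) : A := counit s + R (nested R s)

/-- The unital image of `nested` under the operator `R + θ`. -/
def rightPart (θ : k) (R : A →ₗ[k] A) (s : Multiset A) : A := leftPart R s + θ • nested R s

theorem conv_leftPart_single (R : A →ₗ[k] A) : conv (leftPart R) single = nested R :=
  Classical.choose_spec (exists_nested R)

@[simp] theorem nested_zero (R : A →ₗ[k] A) : nested R 0 = 0 := by
  rw [← conv_leftPart_single]; simp

@[simp] theorem leftPart_zero (R : A →ₗ[k] A) : leftPart R 0 = 1 := by simp [leftPart]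

@[simp] theorem rightPart_zero (θ : k) (R : A →ₗ[k] A) : rightPart θ R 0 = 1 := by simp [rightPart]

@[simp] theorem nested_singleton (R : A →ₗ[k] A) (a : A) : nested R {a} = a := by
  rw [← conv_leftPart_single, ← cons_zero, conv_cons]
  simp

@[simp] theorem leftPart_singleton (R : A →ₗ[k] A) (a : A) : leftPart R {a} = R a := by
  simp [leftPart, counit]

@[simp] theorem rightPart_singleton (θ : k) (R : A →ₗ[k] A) (a : A) :
    rightPart θ R {a} = R a + θ • a := by
  simp [rightPart]

/-- This is L ⋆ B = a·M with the counit term of L moved to the other side. The remaining kernel `R ∘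
nested R` vanishes at `0`, so the equation is recursive. -/
theorem exists_brace (θ : k) (R : A →ₗ[k] A) (a : A) :
    ∃ B : Multiset A → A, (fun s => a * rightPart θ R s - conv (fun u => R (nested R u)) B s) = B :=
  exists_fixedPoint (fun B s => a * rightPart θ R s - conv (fun u => R (nested R u)) B s)
    fun X Y s h => by
      rw [conv_congr_right (K := fun u => R (nested R u)) (by simp) fun u _ hu => h u hu]

/-- The symmetric brace operations of the pre-Lie algebra of a Rota--Baxter algebra. -/
def brace (θ : k) (R : A →ₗ[k] A) (a : A) : Multiset A → A := Classical.choose (exists_brace θ R a)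

theorem conv_leftPart_brace (θ : k) (R : A →ₗ[k] A) (a : A) (s : Multiset A) :
    conv (leftPart R) (brace θ R a) s = a * rightPart θ R s := by
  have h : _ = brace θ R a s := congrFun (Classical.choose_spec (exists_brace θ R a)) s
  have h2 : conv (leftPart R) (brace θ R a) s =
      brace θ R a s + conv (fun u => R (nested R u)) (brace θ R a) s := by
    conv_rhs => rw [← congrFun (counit_conv (brace θ R a)) s]
    rw [← conv_add_left]
    rfl
  rw [h2, ← h]
  exact sub_add_cancel _ _

@[simp] theorem brace_zero (θ : k) (R : A →ₗ[k] A) (a : A) : brace θ R a 0 = a := by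
  simpa using conv_leftPart_brace θ R a 0

end RotaBaxter

/-! ### Recursion on rooted trees -/

mutual
/-- Recursion on planar trees. -/
def PTree.fold {D β : Type*} (g : D → Multiset β → β) : PTree D → β
  | .node d l => g d (PTree.foldList g l)
/-- Recursion on lists of planar trees. -/
def PTree.foldList {D β : Type*} (g : D → Multiset β → β) : List (PTree D) → List β
  | [] => []
  | t :: l => PTree.fold g t :: PTree.foldList g l
end

theorem PTree.foldList_eq {D β : Type*} (g : D → Multiset β → β) (l : List (PTree D)) :
    PTree.foldList g l = l.map (PTree.fold g) := by
  induction l with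
  | nil => rfl
  | cons t l ih => rw [PTree.foldList, ih, List.map_cons]

theorem PTree.fold_rel {D β : Type*} (g : D → Multiset β → β) {t t' : PTree D}
    (h : PTree.Rel t t') : PTree.fold g t = PTree.fold g t' := by
  induction h with
  | perm d h =>
    simp only [PTree.fold, PTree.foldList_eq]
    rw [Multiset.coe_eq_coe.2 (h.map _)]
  | congr d l₁ l₂ _ ih =>
    simp only [PTree.fold, PTree.foldList_eq, List.map_append, List.map_cons, ih]

namespace RTree

variable {D β : Type*}

/-- Recursion on rooted trees. -/
def fold (g : D → Multiset β → β) : RTree D → β :=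
  Quot.lift (PTree.fold g) fun _ _ h => PTree.fold_rel g h

theorem fold_node (g : D → Multiset β → β) (d : D) (F : Multiset (RTree D)) :
    fold g (node d F) = g d (F.map (fold g)) := by
  have h : PTree.fold g ∘ out = fold g := by
    funext t
    conv_rhs => rw [← mk_out t]
    rfl
  change PTree.fold g (.node d (F.toList.map out)) = _
  rw [PTree.fold, PTree.foldList_eq, List.map_map, h, ← Multiset.map_coe, Multiset.coe_toList]

theorem induction_on {p : RTree D → Prop} (t : RTree D)
    (h : ∀ (d : D) (F : Multiset (RTree D)), (∀ s ∈ F, p s) → p (node d F)) : p t := by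
  rw [← mk_out t]
  -- The branches form a nested list, which needs its own motive.
  refine PTree.rec (motive_1 := fun t => p (mk t)) (motive_2 := fun l => ∀ t ∈ l, p (mk t))
    ?_ ?_ ?_ _
  · intro d l hl
    rw [← node_mk]
    exact h d _ (by simpa using hl)
  · simp
  · intro t l ht hl
    simpa using ⟨ht, hl⟩

/-- The number of vertices of a tree. -/
def size : RTree D → ℕ := fold fun _ F => F.sum + 1

theorem size_node (d : D) (F : Multiset (RTree D)) : size (node d F) = (F.map size).sum + 1 :=
  fold_node _ d F

end RTree

/-! ### Linear maps on the Grossman--Larson algebra -/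

namespace GrossmanLarson

open Multiset

variable {k D : Type*} [Field k]

theorem hom_ext {V : Type*} [AddCommGroup V] [Module k V] {f g : GrossmanLarson k D →ₗ[k] V}
    (h : ∀ F, f (forest k F) = g (forest k F)) : f = g :=
  LinearMap.ext fun y => LinearMap.eqOn_span (s := Set.range (forest k (D := D)))
    (by rintro _ ⟨F, rfl⟩; exact h F) (mem_span_forest y)

@[simp] theorem ofTrees_single (t : RTree D) : ofTrees k (Finsupp.single t 1) = forest k {t} := by
  simp [ofTrees]

theorem forest_zero : forest k (0 : Multiset (RTree D)) = 1 := rfl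

theorem forest_cons (t : RTree D) (F : Multiset (RTree D)) :
    forest k (t ::ₘ F) = forest k {t} * forest k F := by
  rw [forest_mul, singleton_add]

-- Convolution of linear maps on forests

variable {A : Type*} [Ring A] [Algebra k A]

/-- The convolution product dual to the unshuffling of forests. -/
def convolve (X Y : GrossmanLarson k D →ₗ[k] A) : GrossmanLarson k D →ₗ[k] A :=
  extend k (conv (fun F => X (forest k F)) fun F => Y (forest k F))

theorem convolve_forest (X Y : GrossmanLarson k D →ₗ[k] A) (F : Multiset (RTree D)) :
    convolve X Y (forest k F) = conv (fun F => X (forest k F)) (fun F => Y (forest k F)) F :=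
  extend_forest _ _

theorem convolve_extend (X Y : Multiset (RTree D) → A) :
    convolve (extend k X) (extend k Y) = extend k (conv X Y) :=
  hom_ext fun F => by simp [convolve_forest]

theorem convolve_add_left (X X' Y : GrossmanLarson k D →ₗ[k] A) :
    convolve (X + X') Y = convolve X Y + convolve X' Y :=
  hom_ext fun F => by simp [convolve_forest, conv, add_mul]

theorem convolve_add_right (X Y Y' : GrossmanLarson k D →ₗ[k] A) :
    convolve X (Y + Y') = convolve X Y + convolve X Y' :=
  hom_ext fun F => by simp [convolve_forest, conv, mul_add]

theorem convolve_smul_left (c : k) (X Y : GrossmanLarson k D →ₗ[k] A) :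
    convolve (c • X) Y = c • convolve X Y :=
  hom_ext fun F => by simp [convolve_forest, conv, Multiset.smul_sum]

theorem convolve_smul_right (c : k) (X Y : GrossmanLarson k D →ₗ[k] A) :
    convolve X (c • Y) = c • convolve X Y :=
  hom_ext fun F => by simp [convolve_forest, conv, Multiset.smul_sum]

/-- The linear map `z ↦ X (y z)`. -/
def translate (y : GrossmanLarson k D) (X : GrossmanLarson k D →ₗ[k] A) :
    GrossmanLarson k D →ₗ[k] A :=
  X ∘ₗ LinearMap.mulLeft k y

@[simp] theorem translate_apply (y z : GrossmanLarson k D) (X : GrossmanLarson k D →ₗ[k] A) :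
    translate y X z = X (y * z) := rfl

theorem translate_add (y y' : GrossmanLarson k D) (X : GrossmanLarson k D →ₗ[k] A) :
    translate (y + y') X = translate y X + translate y' X :=
  LinearMap.ext fun z => by simp [add_mul]

theorem translate_smul (c : k) (y : GrossmanLarson k D) (X : GrossmanLarson k D →ₗ[k] A) :
    translate (c • y) X = c • translate y X :=
  LinearMap.ext fun z => by simp

theorem translate_zero (X : GrossmanLarson k D →ₗ[k] A) : translate 0 X = 0 :=
  LinearMap.ext fun z => by simp

/-- Trees are primitive for the unshuffling coproduct. -/
theorem convolve_translate (X Y : GrossmanLarson k D →ₗ[k] A) (x : TreeSpan k D) :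
    translate (ofTrees k x) (convolve X Y) =
      convolve X (translate (ofTrees k x) Y) + convolve (translate (ofTrees k x) X) Y := by
  induction x using Finsupp.induction_linear with
  | zero =>
    refine hom_ext fun F => ?_
    simp [translate_zero, convolve_forest, conv]
  | add x y hx hy =>
    simp only [_root_.map_add, translate_add, convolve_add_right, convolve_add_left, hx, hy]
    abel
  | single t c =>
    rw [← mul_one c, ← smul_eq_mul, ← Finsupp.smul_single, map_smul]
    simp only [translate_smul, convolve_smul_left, convolve_smul_right, ← smul_add]
    congr 1
    refine hom_ext fun F => ?_
    simp only [ofTrees_single, translate_apply, ← forest_cons, convolve_forest, LinearMap.add_apply,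
      conv_cons]

/-- The Grossman--Larson product is compatible with the unshuffling coproduct. -/
theorem convolve_starForest (X Y : GrossmanLarson k D →ₗ[k] A) (F G : Multiset (RTree D)) :
    convolve X Y (starForest k F G) =
      (F.antidiagonal.map fun p => (G.antidiagonal.map fun q =>
        X (starForest k p.1 q.1) * Y (starForest k p.2 q.2)).sum).sum := by
  induction F using Multiset.induction_on generalizing X Y G with
  | empty => simp [starForest_zero, convolve_forest, conv]
  | cons t F ih =>
    -- The factor `t ↶ r.1` is a combination of trees, hence primitive: it goes wholly to `Y` or
    -- wholly to `X`.
    have h (r : Multiset (RTree D) × Multiset (RTree D)) :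
        convolve X Y (ofTrees k (act k t r.1) * starForest k F r.2) =
        (F.antidiagonal.map fun p => (r.2.antidiagonal.map fun q =>
          X (starForest k p.1 q.1) * Y (ofTrees k (act k t r.1) * starForest k p.2 q.2)).sum).sum +
        (F.antidiagonal.map fun p => (r.2.antidiagonal.map fun q =>
          X (ofTrees k (act k t r.1) * starForest k p.1 q.1) * Y (starForest k p.2 q.2)).sum).sum := by
      rw [← translate_apply, convolve_translate, LinearMap.add_apply, ih, ih]
      rfl
    rw [starForest_cons, map_multiset_sum, Multiset.map_map]
    simp only [Function.comp_def, h, sum_map_add, antidiagonal_cons, Multiset.map_add, sum_add,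
      Multiset.map_map, Prod.map_fst, Prod.map_snd, id]
    congr 1
    -- `t` on the `Y` side: the part of `G` grafted on `t` must be regrouped with the second part,
    -- past the first.
    · rw [sum_map_sum_map]
      refine congrArg sum (map_congr rfl fun p _ => ?_)
      rw [antidiagonal_sum_left_comm fun r q q' =>
        X (starForest k p.1 q) * Y (ofTrees k (act k t r) * starForest k p.2 q')]
      simp only [starForest_cons, map_multiset_sum, Multiset.map_map, Function.comp_def,
        sum_map_mul_left]
    -- `t` on the `X` side: coassociativity alone regroups the parts of `G`.
    · rw [sum_map_sum_map]
      refine congrArg sum (map_congr rfl fun p _ => ?_)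
      rw [← antidiagonal_sum_assoc fun r q q' =>
        X (ofTrees k (act k t r) * starForest k p.1 q) * Y (starForest k p.2 q')]
      simp only [starForest_cons, map_multiset_sum, Multiset.map_map, Function.comp_def,
        sum_map_mul_right]

-- The counit and the projection onto single trees

/-- The counit of the Grossman--Larson algebra, with values in `A`. -/
def counitHom (k D A : Type*) [Field k] [Ring A] [Algebra k A] : GrossmanLarson k D →ₗ[k] A :=
  extend k counit

@[simp] theorem counitHom_forest (F : Multiset (RTree D)) :
    counitHom k D A (forest k F) = counit F := extend_forest _ _

theorem counitHom_ofTrees_mul (x : TreeSpan k D) (z : GrossmanLarson k D) :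
    counitHom k D A (ofTrees k x * z) = 0 := by
  have h : translate (ofTrees k x) (counitHom k D A) = 0 := by
    induction x using Finsupp.induction_linear with
    | zero => simp [translate_zero]
    | add x y hx hy => rw [_root_.map_add, translate_add, hx, hy, add_zero]
    | single t c =>
      rw [← mul_one c, ← smul_eq_mul, ← Finsupp.smul_single, map_smul, translate_smul]
      refine hom_ext fun F => ?_
      rw [LinearMap.smul_apply, ofTrees_single, translate_apply, ← forest_cons]
      simp
  exact LinearMap.congr_fun h z

theorem counitHom_starForest (F G : Multiset (RTree D)) :
    counitHom k D A (starForest k F G) = counit F * counit G := by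
  induction F using Multiset.induction_on with
  | empty => simp [starForest_zero]
  | cons t F ih =>
    rw [starForest_cons, map_multiset_sum, Multiset.map_map]
    simp [counitHom_ofTrees_mul]

/-- The linear map which vanishes on the forests that are not trees and sends each tree to its
image under `φ`. -/
def treePart (φ : RTree D → A) : GrossmanLarson k D →ₗ[k] A :=
  extend k fun F => RotaBaxter.single (F.map φ)

/-- A tree times a forest is again a single tree only if that forest is empty. -/
theorem treePart_ofTrees_mul (φ : RTree D → A) (x : TreeSpan k D) (z : GrossmanLarson k D) :
    treePart φ (ofTrees k x * z) = Finsupp.linearCombination k φ x * counitHom k D A z := by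
  have h : translate (ofTrees k x) (treePart φ) =
      LinearMap.mulLeft k (Finsupp.linearCombination k φ x) ∘ₗ counitHom k D A := by
    induction x using Finsupp.induction_linear with
    | zero => ext; simp
    | add x y hx hy =>
      rw [_root_.map_add, translate_add, hx, hy]
      ext; simp [add_mul]
    | single t c =>
      rw [← mul_one c, ← smul_eq_mul, ← Finsupp.smul_single, map_smul, translate_smul]
      refine hom_ext fun F => ?_
      rw [LinearMap.smul_apply, ofTrees_single, translate_apply, ← forest_cons]
      simp [treePart]
  exact LinearMap.congr_fun h z

theorem treePart_starForest_zero (φ : RTree D → A) (G : Multiset (RTree D)) :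
    treePart φ (starForest k 0 G) = RotaBaxter.single (G.map φ) := by
  rw [starForest_zero, treePart, extend_forest]

/-- The product never merges the trees of the left factor, so a single tree arises only when `F` is
empty and all of `G` is grafted on `t`. -/
theorem treePart_starForest_cons (φ : RTree D → A) (t : RTree D) (F G : Multiset (RTree D)) :
    treePart φ (starForest k (t ::ₘ F) G) =
      Finsupp.linearCombination k φ (act k t G) * counit F := by
  rw [starForest_cons, map_multiset_sum, Multiset.map_map]
  simp only [Function.comp_def, treePart_ofTrees_mul, counitHom_starForest]
  have h := congrFun (conv_counit fun u => Finsupp.linearCombination k φ (act k t u)) G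
  rw [← h, conv, ← sum_map_mul_right]
  refine congrArg sum (map_congr rfl fun p _ => ?_)
  rw [counit_mul_comm F, mul_assoc]

end GrossmanLarson

/-! ### The canonical map to a Rota--Baxter algebra -/

namespace RotaBaxter

open Multiset GrossmanLarson

variable {k D A : Type*} [Field k] [Ring A] [Algebra k A] (θ : k) (R : A →ₗ[k] A) (f : D → A)

/-- The image of a tree under the canonical map. -/
def ofTree : RTree D → A := RTree.fold fun d F => brace θ R (f d) F

theorem ofTree_node (d : D) (F : Multiset (RTree D)) :
    ofTree θ R f (RTree.node d F) = brace θ R (f d) (F.map (ofTree θ R f)) :=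
  RTree.fold_node _ d F

/-- The canonical map on the span of trees. -/
def treeHom : TreeSpan k D →ₗ[k] A := Finsupp.linearCombination k (ofTree θ R f)

/-- The canonical map, extended by `0` to the empty forest. -/
def forestHom : GrossmanLarson k D →ₗ[k] A :=
  extend k fun F => nested R (F.map (ofTree θ R f))

/-- The linear extension of `leftPart` to forests. -/
def leftHom : GrossmanLarson k D →ₗ[k] A :=
  extend k fun F => leftPart R (F.map (ofTree θ R f))

/-- The linear extension of `rightPart` to forests. -/
def rightHom : GrossmanLarson k D →ₗ[k] A :=
  extend k fun F => rightPart θ R (F.map (ofTree θ R f))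

@[simp] theorem forestHom_forest (F : Multiset (RTree D)) :
    forestHom θ R f (forest k F) = nested R (F.map (ofTree θ R f)) := extend_forest _ _

@[simp] theorem leftHom_forest (F : Multiset (RTree D)) :
    leftHom θ R f (forest k F) = leftPart R (F.map (ofTree θ R f)) := extend_forest _ _

@[simp] theorem rightHom_forest (F : Multiset (RTree D)) :
    rightHom θ R f (forest k F) = rightPart θ R (F.map (ofTree θ R f)) := extend_forest _ _

@[simp] theorem treeHom_single (t : RTree D) :
    treeHom θ R f (Finsupp.single t 1) = ofTree θ R f t := by simp [treeHom]

theorem leftHom_apply (z : GrossmanLarson k D) :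
    leftHom θ R f z = counitHom k D A z + R (forestHom θ R f z) := by
  have h : leftHom θ R f = counitHom k D A + R ∘ₗ forestHom θ R f :=
    hom_ext fun F => by simp [leftPart]
  exact LinearMap.congr_fun h z

theorem rightHom_apply (z : GrossmanLarson k D) :
    rightHom θ R f z = leftHom θ R f z + θ • forestHom θ R f z := by
  have h : rightHom θ R f = leftHom θ R f + θ • forestHom θ R f :=
    hom_ext fun F => by simp [rightPart]
  exact LinearMap.congr_fun h z

/-- The equation P = L ⋆ `single` as an identity of linear maps, which can thus be evaluated at
Grossman–Larson products. -/
theorem convolve_leftHom_treePart :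
    convolve (leftHom θ R f) (treePart (ofTree θ R f)) = forestHom θ R f :=
  hom_ext fun F => by
    simp only [leftHom, treePart, convolve_extend, extend_forest, forestHom]
    rw [← conv_comp_map (leftPart R) single, conv_leftPart_single]

theorem forestHom_ofTrees (x : TreeSpan k D) :
    forestHom θ R f (GrossmanLarson.ofTrees k x) = treeHom θ R f x := by
  have h : forestHom θ R f ∘ₗ GrossmanLarson.ofTrees k = treeHom θ R f := by
    refine Finsupp.lhom_ext' fun t => LinearMap.ext_ring ?_
    simp
  exact LinearMap.congr_fun h x

-- Images of grafting and of the Grossman–Larson product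

/-- Compatibility of the image of the tree `t` with attaching forests to `t`. -/
def IsGraftCompatible (t : RTree D) : Prop :=
  ∀ G : Multiset (RTree D),
    conv (fun u => leftPart R (u.map (ofTree θ R f))) (fun u => treeHom θ R f (act k t u)) G =
      ofTree θ R f t * rightPart θ R (G.map (ofTree θ R f))

variable {θ R f}

/-- For empty `F` this is the recursion for `nested` on `G`. For one tree it is the compatibility of
that tree, and for more trees both sides vanish. -/
theorem conv_treePart_starForest {F : Multiset (RTree D)}
    (hF : ∀ t ∈ F, IsGraftCompatible θ R f t) (G : Multiset (RTree D)) :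
    conv (fun u => leftPart R (u.map (ofTree θ R f)))
      (fun u => treePart (k := k) (ofTree θ R f) (starForest k F u)) G =
    counit F * nested R (G.map (ofTree θ R f)) +
      single (F.map (ofTree θ R f)) * rightPart θ R (G.map (ofTree θ R f)) := by
  rcases Multiset.empty_or_exists_mem F with rfl | ⟨t, ht⟩
  · simp only [treePart_starForest_zero]
    rw [← conv_comp_map (leftPart R) single, conv_leftPart_single]
    simp
  · obtain ⟨F, rfl⟩ := exists_cons_of_mem ht
    have h := hF t (mem_cons_self t F) G
    simp only [treePart_starForest_cons, counit_cons, zero_mul, zero_add, Multiset.map_cons,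
      single_cons, counit_map]
    rw [mul_assoc, counit_mul_comm F, ← mul_assoc, ← h, conv_mul_const]
    rfl

/-- Applying R to the formula for P(F∗G) produces exactly the Rota–Baxter expansion of
R(P(F))R(P(G)), plus counit terms. Multiplicativity of M then needs only M = L + θP. -/
theorem hom_starForest_of_forestHom (hR : IsRotaBaxter θ R) {F G : Multiset (RTree D)}
    (h : forestHom θ R f (starForest k F G) =
      leftPart R (F.map (ofTree θ R f)) * nested R (G.map (ofTree θ R f)) +
        nested R (F.map (ofTree θ R f)) * rightPart θ R (G.map (ofTree θ R f))) :
    leftHom θ R f (starForest k F G) =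
        leftPart R (F.map (ofTree θ R f)) * leftPart R (G.map (ofTree θ R f)) ∧
    rightHom θ R f (starForest k F G) =
        rightPart θ R (F.map (ofTree θ R f)) * rightPart θ R (G.map (ofTree θ R f)) := by
  have h1 : leftHom θ R f (starForest k F G) =
      leftPart R (F.map (ofTree θ R f)) * leftPart R (G.map (ofTree θ R f)) := by
    rw [leftHom_apply, h, counitHom_starForest]
    simp only [leftPart, rightPart, counit_map, add_mul, mul_add, hR _ _, _root_.map_add, map_smul,
      mul_smul_comm]
    -- The counit takes only the values `0` and `1`, so it passes through `R`.
    have e1 : R (counit F * nested R (G.map (ofTree θ R f))) =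
        counit F * R (nested R (G.map (ofTree θ R f))) := by
      unfold counit; split_ifs <;> simp
    have e2 : R (nested R (F.map (ofTree θ R f)) * counit G) =
        R (nested R (F.map (ofTree θ R f))) * counit G := by
      unfold counit; split_ifs <;> simp
    rw [e1, e2]
    abel
  refine ⟨h1, ?_⟩
  rw [rightHom_apply, h1, h]
  simp only [rightPart, add_mul, mul_add, smul_add, mul_smul_comm, smul_mul_assoc]
  abel

/-- Expand P = L ⋆ τ at F∗G, where τ is `treePart`. By induction L is multiplicative on the smaller
pairs that occur, so the sum becomes a convolution in `G` followed by one in `F`. -/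
theorem forestHom_starForest (hR : IsRotaBaxter θ R) {F : Multiset (RTree D)}
    (hF : ∀ t ∈ F, IsGraftCompatible θ R f t) (G : Multiset (RTree D)) :
    forestHom θ R f (starForest k F G) =
      leftPart R (F.map (ofTree θ R f)) * nested R (G.map (ofTree θ R f)) +
        nested R (F.map (ofTree θ R f)) * rightPart θ R (G.map (ofTree θ R f)) := by
  induction hn : card F + card G using Nat.strong_induction_on generalizing F G with
  | _ n ih =>
    have step : forestHom θ R f (starForest k F G) =
        conv (fun u => leftPart R (u.map (ofTree θ R f))) (fun v =>
          conv (fun u => leftPart R (u.map (ofTree θ R f)))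
            (fun u => treePart (k := k) (ofTree θ R f) (starForest k v u)) G) F := by
      rw [← convolve_leftHom_treePart, convolve_starForest, conv]
      refine congrArg sum (map_congr rfl fun p hp => ?_)
      rw [conv, ← sum_map_mul_left]
      refine congrArg sum (map_congr rfl fun q hq => ?_)
      rw [mem_antidiagonal] at hp hq
      rw [← mul_assoc]
      -- The only term with L at the full pair `(F, G)` is killed by `treePart` of the empty forest.
      by_cases h0 : p.2 = 0 ∧ q.2 = 0
      · simp [h0.1, h0.2, treePart_starForest_zero]
      · have hc : card p.1 + card q.1 < n := by
          rw [← hn, ← hp, ← hq, card_add, card_add]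
          have : 0 < card p.2 ∨ 0 < card q.2 := by
            rw [card_pos, card_pos]
            tauto
          omega
        rw [(hom_starForest_of_forestHom hR
          (ih _ hc (fun t ht => hF t (hp ▸ mem_add.2 (Or.inl ht))) q.1 rfl)).1]
    have step2 : forestHom θ R f (starForest k F G) =
        conv (fun u => leftPart R (u.map (ofTree θ R f))) (fun v =>
          counit v * nested R (G.map (ofTree θ R f)) +
            single (v.map (ofTree θ R f)) * rightPart θ R (G.map (ofTree θ R f))) F := by
      rw [step, conv, conv]
      refine congrArg sum (map_congr rfl fun p hp => ?_)
      rw [mem_antidiagonal] at hp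
      rw [conv_treePart_starForest fun t ht => hF t (hp ▸ mem_add.2 (Or.inr ht))]
    rw [step2, conv_add_right, conv_mul_const, conv_mul_const, conv_counit,
      ← conv_comp_map (leftPart R) single, conv_leftPart_single]

/-- For the tree with root `d` and branches `F`, grafting `G` amounts to forming F∗G below `d`. The
brace equation at F∗G, with L and M multiplicative, gives the claim convolved with L in `F`. -/
theorem isGraftCompatible (hR : IsRotaBaxter θ R) (t : RTree D) : IsGraftCompatible θ R f t := by
  induction t using RTree.induction_on with
  | h d F hF =>
    intro G
    let b : GrossmanLarson k D →ₗ[k] A :=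
      extend k fun F => brace θ R (f d) (F.map (ofTree θ R f))
    have hb (z : GrossmanLarson k D) : treeHom θ R f (bPlus k d z) = b z := by
      have : treeHom θ R f ∘ₗ bPlus k d = b := hom_ext fun F => by
        simp [b, bPlus, ofTree_node]
      exact LinearMap.congr_fun this z
    -- The brace equation in linear form, needed because F∗G is a combination of forests.
    have hconv : convolve (leftHom θ R f) b = LinearMap.mulLeft k (f d) ∘ₗ rightHom θ R f :=
      hom_ext fun F => by
        simp only [leftHom, b, convolve_extend, extend_forest, LinearMap.comp_apply, rightHom]
        rw [← conv_comp_map (leftPart R) (brace θ R (f d)), conv_leftPart_brace]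
        rfl
    simp only [act_node, hb, ofTree_node]
    -- Cancelling L in the variable `F` needs the identity on all subforests `u` of `F`, where the
    -- induction hypothesis still applies.
    refine eq_of_conv_eq (W := fun u => leftPart R (u.map (ofTree θ R f)))
      (X := fun F => conv (fun u => leftPart R (u.map (ofTree θ R f)))
        (fun u => b (starForest k F u)) G)
      (Y := fun F => brace θ R (f d) (F.map (ofTree θ R f)) *
        rightPart θ R (G.map (ofTree θ R f))) (by simp) fun u hu => ?_
    have hu' : ∀ v ≤ u, ∀ t ∈ v, IsGraftCompatible θ R f t :=
      fun v hv t ht => hF t (mem_of_le (hv.trans hu) ht)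
    have h1 := LinearMap.congr_fun hconv (starForest k u G)
    rw [LinearMap.comp_apply, LinearMap.mulLeft_apply,
      (hom_starForest_of_forestHom hR (forestHom_starForest hR (hu' u le_rfl) G)).2, ← mul_assoc,
      ← conv_leftPart_brace θ R (f d) (u.map _), convolve_starForest] at h1
    rw [conv_mul_const, ← conv_comp_map (leftPart R) (brace θ R (f d)), ← h1, conv]
    refine congrArg sum (map_congr rfl fun p hp => ?_)
    rw [mem_antidiagonal] at hp
    rw [conv, ← sum_map_mul_left]
    refine congrArg sum (map_congr rfl fun q _ => ?_)
    rw [← mul_assoc, (hom_starForest_of_forestHom hR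
      (forestHom_starForest hR (hu' p.1 (hp ▸ le_add_right _ _)) q.1)).1]

/-- On nonempty forests the counits vanish, so L = R∘P and M = R∘P + θP, and the product formula
becomes the double product. -/
theorem forestHom_star (hR : IsRotaBaxter θ R) {x y : GrossmanLarson k D}
    (hx : x ∈ Plus k D) (hy : y ∈ Plus k D) :
    forestHom θ R f (star k x y) = rbDouble θ R (forestHom θ R f x) (forestHom θ R f y) := by
  induction hx using Submodule.span_induction with
  | zero => simp [rbDouble]
  | add a b _ _ ha hb =>
    simp only [_root_.map_add, LinearMap.add_apply, ha, hb, rbDouble, add_mul, smul_add]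
    abel
  | smul c a _ ha =>
    simp only [map_smul, LinearMap.smul_apply, ha, rbDouble, smul_mul_assoc, smul_add,
      smul_comm θ c]
  | mem x hx =>
    obtain ⟨F, hF, rfl⟩ := hx
    induction hy using Submodule.span_induction with
    | zero => simp [rbDouble]
    | add a b _ _ ha hb =>
      simp only [_root_.map_add, ha, hb, rbDouble, mul_add, smul_add]
      abel
    | smul c a _ ha =>
      simp only [map_smul, ha, rbDouble, mul_smul_comm, smul_add, smul_comm θ c]
    | mem y hy =>
      obtain ⟨G, hG, rfl⟩ := hy
      rw [GrossmanLarson.star, extend_forest, extend_forest,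
        forestHom_starForest hR (fun t _ => isGraftCompatible hR t)]
      simp only [rightPart, leftPart, counit_map, counit_of_ne_zero hF, counit_of_ne_zero hG,
        zero_add, rbDouble, forestHom_forest, mul_add, mul_smul_comm, add_assoc]

/-- Compatibility at `G = {s}` has two terms on the left: `t ↶ s` itself, and `R(s) t`, where `s` is
not grafted. -/
theorem treeHom_graft (hR : IsRotaBaxter θ R) (x y : TreeSpan k D) :
    treeHom θ R f (graft k x y) = rbPreLie θ R (treeHom θ R f x) (treeHom θ R f y) := by
  have h (t s : RTree D) : treeHom θ R f (act k t {s}) =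
      rbPreLie θ R (ofTree θ R f t) (ofTree θ R f s) := by
    have h1 := isGraftCompatible (f := f) hR t 0
    have h2 := isGraftCompatible (f := f) hR t {s}
    rw [← cons_zero, conv_cons] at h2
    simp only [conv_zero, Multiset.map_zero, cons_zero, map_singleton, leftPart_zero, one_mul,
      rightPart_zero, mul_one, leftPart_singleton, rightPart_singleton] at h1 h2
    rw [h1] at h2
    rw [rbPreLie, eq_sub_of_add_eq h2, mul_add, mul_smul_comm]
    abel
  induction x using Finsupp.induction_linear with
  | zero => simp [rbPreLie]
  | add a b ha hb =>
    rw [_root_.map_add, LinearMap.add_apply, _root_.map_add, _root_.map_add, ha, hb]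
    simp only [rbPreLie, add_mul, mul_add, smul_add]
    abel
  | single t c =>
    rw [← mul_one c, ← smul_eq_mul, ← Finsupp.smul_single]
    induction y using Finsupp.induction_linear with
    | zero => simp [rbPreLie]
    | add a b ha hb =>
      rw [_root_.map_add, _root_.map_add, _root_.map_add, ha, hb]
      simp only [rbPreLie, _root_.map_add, add_mul, mul_add, smul_add]
      abel
    | single s c' =>
      rw [← mul_one c', ← smul_eq_mul, ← Finsupp.smul_single]
      simp only [map_smul, LinearMap.smul_apply, treeHom_single, graft,
        Finsupp.linearCombination_single, one_smul, h, rbPreLie, smul_add, smul_sub, mul_smul_comm,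
        smul_mul_assoc, smul_comm θ, smul_comm c c']

end RotaBaxter

/-! ### Generation of the Grossman--Larson algebra by leaves -/

namespace GrossmanLarson

open Multiset

variable {k D : Type*} [Field k]

/-- The hypothesis on the trees of `F` lets this serve as the forest half of the induction on trees
in `act_zero`. -/
theorem starForest_zero_right_of_act {F : Multiset (RTree D)}
    (hF : ∀ t ∈ F, act k t 0 = Finsupp.single t 1) : starForest k F 0 = forest k F := by
  induction F using Multiset.induction_on with
  | empty => exact starForest_zero k 0
  | cons t F ih =>
    rw [starForest_cons, antidiagonal_zero, map_singleton, sum_singleton, ih fun s hs =>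
      hF s (mem_cons_of_mem hs), hF t (mem_cons_self t F), ofTrees_single, ← forest_cons]

theorem act_zero (t : RTree D) : act k t 0 = Finsupp.single t 1 := by
  induction t using RTree.induction_on with
  | h d F hF => rw [act_node, starForest_zero_right_of_act hF, bPlus, extend_forest]

theorem starForest_zero_right (F : Multiset (RTree D)) : starForest k F 0 = forest k F :=
  starForest_zero_right_of_act fun t _ => act_zero t

variable (k D) in
/-- The span of the trees with `n` vertices. -/
def treesOfSize (n : ℕ) : Submodule k (TreeSpan k D) :=
  Submodule.span k {x | ∃ t : RTree D, t.size = n ∧ x = Finsupp.single t 1}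

variable (k D) in
/-- The span of the forests with `c` trees and `n` vertices. -/
def forestsOfSize (c n : ℕ) : Submodule k (GrossmanLarson k D) :=
  Submodule.span k
    {x | ∃ F : Multiset (RTree D), card F = c ∧ (F.map RTree.size).sum = n ∧ x = forest k F}

theorem forest_mem_forestsOfSize (F : Multiset (RTree D)) :
    forest k F ∈ forestsOfSize k D (card F) (F.map RTree.size).sum :=
  Submodule.subset_span ⟨F, rfl, rfl, rfl⟩

theorem ofTrees_mul_mem {m c n : ℕ} {x : TreeSpan k D} (hx : x ∈ treesOfSize k D m)
    {z : GrossmanLarson k D} (hz : z ∈ forestsOfSize k D c n) :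
    ofTrees k x * z ∈ forestsOfSize k D (c + 1) (m + n) := by
  induction hx using Submodule.span_induction with
  | zero => simp
  | add a b _ _ ha hb => rw [_root_.map_add, add_mul]; exact add_mem ha hb
  | smul r a _ ha => rw [map_smul, smul_mul_assoc]; exact Submodule.smul_mem _ _ ha
  | mem x hx =>
    obtain ⟨t, rfl, rfl⟩ := hx
    induction hz using Submodule.span_induction with
    | zero => simp
    | add a b _ _ ha hb => rw [mul_add]; exact add_mem ha hb
    | smul r a _ ha => rw [mul_smul_comm]; exact Submodule.smul_mem _ _ ha
    | mem z hz =>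
      obtain ⟨F, rfl, rfl, rfl⟩ := hz
      rw [ofTrees_single, ← forest_cons]
      simpa using forest_mem_forestsOfSize (k := k) (t ::ₘ F)

theorem bPlus_mem {c n : ℕ} (d : D) {z : GrossmanLarson k D} (hz : z ∈ forestsOfSize k D c n) :
    bPlus k d z ∈ treesOfSize k D (n + 1) := by
  induction hz using Submodule.span_induction with
  | zero => simp
  | add a b _ _ ha hb => rw [_root_.map_add]; exact add_mem ha hb
  | smul r a _ ha => rw [map_smul]; exact Submodule.smul_mem _ _ ha
  | mem z hz =>
    obtain ⟨F, rfl, rfl, rfl⟩ := hz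
    rw [bPlus, extend_forest]
    exact Submodule.subset_span ⟨_, RTree.size_node d F, rfl⟩

/-- If `t` stays ungrafted the result is `tF`. Otherwise it is absorbed by a tree of `F`, and the
number of trees remains `card F`. The hypothesis is discharged by induction on trees in
`act_singleton_mem`. -/
theorem starForest_singleton_of_act (t : RTree D) {F : Multiset (RTree D)}
    (hF : ∀ s ∈ F, act k s {t} ∈ treesOfSize k D (s.size + t.size)) :
    starForest k F {t} - forest k (t ::ₘ F) ∈
      forestsOfSize k D (card F) ((F.map RTree.size).sum + t.size) := by
  induction F using Multiset.induction_on with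
  | empty => simp [starForest_zero]
  | cons s F ih =>
    have h1 : starForest k (s ::ₘ F) {t} - forest k (t ::ₘ s ::ₘ F) =
        ofTrees k (Finsupp.single s 1) * (starForest k F {t} - forest k (t ::ₘ F)) +
          ofTrees k (act k s {t}) * forest k F := by
      rw [starForest_cons, ← cons_zero, antidiagonal_cons]
      simp only [antidiagonal_zero, map_singleton, Multiset.map_add, sum_add, sum_singleton,
        Prod.map_apply, id, act_zero, starForest_zero_right, mul_sub, ofTrees_single, ← forest_cons,
        cons_swap t s]
      abel
    rw [h1, Multiset.map_cons, sum_cons, card_cons]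
    refine add_mem ?_ ?_
    · rw [add_assoc]
      exact ofTrees_mul_mem (Submodule.subset_span ⟨s, rfl, rfl⟩)
        (ih fun u hu => hF u (mem_cons_of_mem hu))
    · rw [add_right_comm]
      exact ofTrees_mul_mem (hF s (mem_cons_self s F)) (forest_mem_forestsOfSize F)

theorem act_singleton_mem (s t : RTree D) :
    act k s {t} ∈ treesOfSize k D (s.size + t.size) := by
  induction s using RTree.induction_on with
  | h d F hF =>
    rw [act_node, RTree.size_node, add_right_comm]
    rw [← sub_add_cancel (starForest k F {t}) (forest k (t ::ₘ F)), _root_.map_add]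
    refine add_mem (bPlus_mem d (starForest_singleton_of_act t hF)) (bPlus_mem (c := card F + 1) d ?_)
    simpa [add_comm] using forest_mem_forestsOfSize (k := k) (t ::ₘ F)

theorem starForest_singleton (t : RTree D) (F : Multiset (RTree D)) :
    starForest k F {t} - forest k (t ::ₘ F) ∈
      forestsOfSize k D (card F) ((F.map RTree.size).sum + t.size) :=
  starForest_singleton_of_act t fun s _ => act_singleton_mem s t

/-- A subspace which contains the leaves and is closed under grafting and under the
Grossman--Larson product contains all nonempty forests. -/
theorem plus_le_of_closed (E : Submodule k (GrossmanLarson k D))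
    (hleaf : ∀ d : D, forest k {RTree.leaf d} ∈ E)
    (hgraft : ∀ x y : TreeSpan k D, ofTrees k x ∈ E → ofTrees k y ∈ E → ofTrees k (graft k x y) ∈ E)
    (hstar : ∀ x y, x ∈ E → y ∈ E → star k x y ∈ E) : Plus k D ≤ E := by
  -- Induction on the number `n` of vertices below the root, then on the number `c` of branches.
  -- Grafting `t` on the tree with branches `F` yields the wanted tree plus trees with the same `n`
  -- and one branch fewer.
  have htree : ∀ n c (d : D) (F : Multiset (RTree D)), (F.map RTree.size).sum = n → card F = c →
      forest k {RTree.node d F} ∈ E := by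
    intro n
    induction n using Nat.strong_induction_on with
    | _ n ihn =>
      intro c
      induction c with
      | zero =>
        intro d F _ hc
        rw [card_eq_zero.1 hc]
        exact hleaf d
      | succ c ihc =>
        intro d F hn hc
        obtain ⟨t, F, rfl⟩ : ∃ t F', F = t ::ₘ F' := by
          obtain ⟨t, ht⟩ := card_pos_iff_exists_mem.1 (by omega : 0 < card F)
          exact ⟨t, exists_cons_of_mem ht⟩
        rw [Multiset.map_cons, sum_cons] at hn
        rw [card_cons, Nat.add_right_cancel_iff] at hc
        -- Positivity of `t.size` makes the tree with branches `F` strictly smaller.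
        have ht : forest k {t} ∈ E ∧ 0 < t.size := by
          induction t using RTree.induction_on with
          | h d' F' _ =>
            rw [RTree.size_node] at hn ⊢
            exact ⟨ihn _ (by omega) _ d' F' rfl rfl, Nat.succ_pos _⟩
        have hg := hgraft (Finsupp.single (RTree.node d F) 1) (Finsupp.single t 1)
          (by rw [ofTrees_single]; exact ihn _ (by omega) _ d F rfl rfl)
          (by rw [ofTrees_single]; exact ht.1)
        have hz : ∀ z ∈ forestsOfSize k D c n, ofTrees k (bPlus k d z) ∈ E := by
          intro z hz
          induction hz using Submodule.span_induction with
          | zero => simp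
          | add a b _ _ ha hb => rw [_root_.map_add, _root_.map_add]; exact add_mem ha hb
          | smul r a _ ha => rw [map_smul, map_smul]; exact Submodule.smul_mem _ _ ha
          | mem z hz =>
            obtain ⟨G, hG, hG', rfl⟩ := hz
            rw [bPlus, extend_forest, ofTrees_single]
            exact ihc d G hG' hG
        have hs := hz _ (by
          have := starForest_singleton (k := k) t F
          rwa [hc, add_comm, hn] at this)
        have e : graft k (Finsupp.single (RTree.node d F) (1 : k)) (Finsupp.single t 1) =
            bPlus k d (starForest k F {t}) := by
          simp [graft, act_node]
        rw [map_sub, map_sub, ← e] at hs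
        have := sub_mem hg hs
        rwa [sub_sub_cancel, bPlus, extend_forest, ofTrees_single] at this
  have htree' (t : RTree D) : forest k {t} ∈ E := by
    induction t using RTree.induction_on with
    | h d F _ => exact htree _ _ d F rfl rfl
  -- Induction on the number of trees: F∗t differs from `tF` by forests with one tree fewer than
  -- `tF`.
  have hforest : ∀ c (F : Multiset (RTree D)), card F = c + 1 → forest k F ∈ E := by
    intro c
    induction c with
    | zero =>
      intro F hF
      obtain ⟨t, rfl⟩ := card_eq_one.1 hF
      exact htree' t
    | succ c ih =>
      intro F hF
      obtain ⟨t, F, rfl⟩ : ∃ t F', F = t ::ₘ F' := by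
        obtain ⟨t, ht⟩ := card_pos_iff_exists_mem.1 (by omega : 0 < card F)
        exact ⟨t, exists_cons_of_mem ht⟩
      rw [card_cons, Nat.add_right_cancel_iff] at hF
      have h1 := hstar _ _ (ih F hF) (htree' t)
      rw [star, extend_forest, extend_forest] at h1
      have h2 : forestsOfSize k D (card F) ((F.map RTree.size).sum + t.size) ≤ E := by
        refine Submodule.span_le.2 ?_
        rintro _ ⟨G, hG, -, rfl⟩
        exact ih G (hG.trans hF)
      have := sub_mem h1 (h2 (starForest_singleton t F))
      rwa [sub_sub_cancel] at this
  refine Submodule.span_le.2 ?_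
  rintro _ ⟨F, hF, rfl⟩
  exact hforest (card F - 1) F (by have := card_pos.2 hF; omega)

/-! ### Symmetric products of elements of the span of trees -/

variable {A : Type*} [Ring A] [Algebra k A]

/-- Once `x` goes to `treePart`, the rest of that factor must be empty, so all of `z` goes to `X`.
-/
theorem convolve_translate_treePart (X : GrossmanLarson k D →ₗ[k] A) (φ : RTree D → A)
    (x : TreeSpan k D) (z : GrossmanLarson k D) :
    convolve X (translate (ofTrees k x) (treePart φ)) z =
      X z * Finsupp.linearCombination k φ x := by
  have h : convolve X (translate (ofTrees k x) (treePart φ)) =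
      LinearMap.mulRight k (Finsupp.linearCombination k φ x) ∘ₗ X := by
    refine hom_ext fun F => ?_
    simp only [convolve_forest, translate_apply, treePart_ofTrees_mul, counitHom_forest,
      ← counit_mul_comm, conv_mul_const, conv_counit]
    rfl
  exact LinearMap.congr_fun h z

/-- Each factor is primitive and `treePart` accepts exactly one, the `j`-th, leaving the others to
`X`. In the induction `X` absorbs the first factor by translation, so it must vary. -/
theorem convolve_treePart_prod (φ : RTree D → A) (n : ℕ) (X : GrossmanLarson k D →ₗ[k] A)
    (x : Fin (n + 1) → TreeSpan k D) :
    convolve X (treePart φ) (∏ i, ofTrees k (x i)) =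
      ∑ j, X (∏ i : Fin n, ofTrees k (x (j.succAbove i))) *
        Finsupp.linearCombination k φ (x j) := by
  induction n generalizing X with
  | zero =>
    rw [Fin.prod_univ_succ, ← translate_apply, convolve_translate, LinearMap.add_apply,
      convolve_translate_treePart]
    simp [← forest_zero, convolve_forest, treePart]
  | succ n ih =>
    rw [Fin.prod_univ_succ, ← translate_apply, convolve_translate, LinearMap.add_apply,
      convolve_translate_treePart, ih, Fin.sum_univ_succ (n := n + 1)]
    refine congrArg₂ _ (by simp) (Finset.sum_congr rfl fun j _ => ?_)
    rw [Fin.prod_univ_succ]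
    simp

end GrossmanLarson

/-- Permutations of `Fin (n + 1)` in terms of the image of the last element. -/
theorem Fin.exists_equiv_perm_succ (n : ℕ) :
    ∃ e : Fin (n + 1) × Equiv.Perm (Fin n) ≃ Equiv.Perm (Fin (n + 1)),
      ∀ j τ, e (j, τ) (Fin.last n) = j ∧ ∀ i, e (j, τ) i.castSucc = j.succAbove (τ i) := by
  -- The last index goes to `j`; the others are permuted by `τ` and then embedded skipping `j`.
  let m : Fin (n + 1) × Equiv.Perm (Fin n) → Equiv.Perm (Fin (n + 1)) := fun p =>
    (finSuccEquivLast.trans (Equiv.optionCongr p.2)).trans (finSuccEquiv' p.1).symm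
  have h1 (j τ) : m (j, τ) (Fin.last n) = j := by simp [m]
  have h2 (j τ i) : m (j, τ) (Fin.castSucc i) = j.succAbove (τ i) := by simp [m]
  have hm : Function.Bijective m := by
    rw [Fintype.bijective_iff_injective_and_card]
    refine ⟨?_, by simp [Fintype.card_perm, Nat.factorial_succ]⟩
    rintro ⟨j, τ⟩ ⟨j', τ'⟩ h
    obtain rfl : j = j' := by rw [← h1 j τ, h, h1]
    refine Prod.ext rfl (Equiv.ext fun i => Fin.succAbove_right_injective (p := j) ?_)
    rw [← h2, h, h2]
  exact ⟨Equiv.ofBijective m hm, fun j τ => ⟨h1 j τ, h2 j τ⟩⟩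

-- Symmetric products as sums over permutations

namespace RotaBaxter

open GrossmanLarson

variable {k D A : Type*} [Field k] [Ring A] [Algebra k A] (θ : k) (R : A →ₗ[k] A) (f : D → A)

/-- The canonical map sends symmetric products of elements of the span of trees to symmetrized
pre-time-ordered products. -/
theorem forestHom_prod (n : ℕ) (x : Fin (n + 1) → TreeSpan k D) :
    forestHom θ R f (∏ i, GrossmanLarson.ofTrees k (x i)) =
      ∑ σ : Equiv.Perm (Fin (n + 1)), rbNested R n fun i => treeHom θ R f (x (σ i)) := by
  induction n with
  | zero => simp [forestHom_ofTrees, rbNested, Subsingleton.elim _ (0 : Fin 1)]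
  | succ n ih =>
    obtain ⟨e, he⟩ := Fin.exists_equiv_perm_succ (n + 1)
    -- The factor selected by `treePart` is the outermost right factor, so permutations are sorted
    -- by their value at the last index.
    rw [← convolve_leftHom_treePart, convolve_treePart_prod, ← e.sum_comp, Fintype.sum_prod_type]
    refine Finset.sum_congr rfl fun j _ => ?_
    -- At least one factor remains, so L reduces to R∘P.
    have hc : counitHom k D A
        (∏ i : Fin (n + 1), GrossmanLarson.ofTrees k (x (j.succAbove i))) = 0 := by
      rw [Fin.prod_univ_succ, counitHom_ofTrees_mul]
    rw [leftHom_apply, hc, zero_add, ih, map_sum, Finset.sum_mul]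
    refine Finset.sum_congr rfl fun τ _ => ?_
    simp only [rbNested, (he j τ).1, (he j τ).2]
    rfl

end RotaBaxter

end

-- The theorem

theorem theorem3p5 {k : Type*} [Field k] [CharZero k] (D : Type*) (θ : k) :
    ∃ ι : GrossmanLarson.Plus k D →ₗ[k] FreeRB D θ,
      IsCanonical θ ι ∧
      (∀ ι' : GrossmanLarson.Plus k D →ₗ[k] FreeRB D θ, IsCanonical θ ι' → ι' = ι) ∧
      (∀ (n : ℕ) (b : Fin (n + 1) → D),
        ι (GrossmanLarson.Plus.symProd fun i => Finsupp.single (RTree.leaf (b i)) 1) =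
          ∑ σ : Equiv.Perm (Fin (n + 1)),
            rbNested (FreeRB.op D θ) n fun i => FreeRB.of (b (σ i))) ∧
      (∀ (n : ℕ) (c : D →₀ k),
        ι (GrossmanLarson.Plus.symProd fun _ : Fin (n + 1) =>
            c.sum fun d r => Finsupp.single (RTree.leaf d) r) =
          (n + 1).factorial •
            rbNested (FreeRB.op D θ) n fun _ => c.sum fun d r => r • FreeRB.of d) := by
  have hR := FreeRB.isRotaBaxter_op D θ
  have hleaf (d : D) : RotaBaxter.ofTree θ (FreeRB.op D θ) FreeRB.of (RTree.leaf d) =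
      FreeRB.of d := by
    rw [RTree.leaf, RotaBaxter.ofTree_node, Multiset.map_zero, RotaBaxter.brace_zero]
  have htrees (x : TreeSpan k D) :
      (RotaBaxter.forestHom θ (FreeRB.op D θ) FreeRB.of ∘ₗ (GrossmanLarson.Plus k D).subtype)
        (GrossmanLarson.Plus.ofTrees x) = RotaBaxter.treeHom θ (FreeRB.op D θ) FreeRB.of x :=
    RotaBaxter.forestHom_ofTrees _ _ _ x
  have hcan : IsCanonical θ (RotaBaxter.forestHom θ (FreeRB.op D θ) FreeRB.of ∘ₗ
      (GrossmanLarson.Plus k D).subtype) := by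
    refine ⟨fun d => ?_, fun x y => ?_, fun x y => RotaBaxter.forestHom_star hR x.2 y.2⟩
    · rw [htrees, RotaBaxter.treeHom_single, hleaf]
    · rw [htrees, htrees, htrees, RotaBaxter.treeHom_graft hR]
  refine ⟨_, hcan, fun ι' hι' => ?_, fun n b => ?_, fun n c => ?_⟩
  -- The locus where two canonical maps agree contains the leaves and is closed under both
  -- operations.
  · have h := GrossmanLarson.plus_le_of_closed
      ((LinearMap.eqLocus ι' (RotaBaxter.forestHom θ (FreeRB.op D θ) FreeRB.of ∘ₗ
        (GrossmanLarson.Plus k D).subtype)).map (GrossmanLarson.Plus k D).subtype) ?_ ?_ ?_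
    · refine LinearMap.ext fun x => ?_
      obtain ⟨y, hy, hxy⟩ := h x.2
      obtain rfl : y = x := Subtype.ext hxy
      exact hy
    · intro d
      refine ⟨GrossmanLarson.Plus.ofTrees (Finsupp.single (RTree.leaf d) 1),
        (hι'.map_leaf d).trans (hcan.map_leaf d).symm, GrossmanLarson.ofTrees_single _⟩
    · rintro x y ⟨x', hx, hxx⟩ ⟨y', hy, hyy⟩
      obtain rfl : x' = GrossmanLarson.Plus.ofTrees x := Subtype.ext hxx
      obtain rfl : y' = GrossmanLarson.Plus.ofTrees y := Subtype.ext hyy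
      refine ⟨GrossmanLarson.Plus.ofTrees (GrossmanLarson.graft k x y), ?_, rfl⟩
      refine (hι'.map_graft x y).trans (Eq.trans ?_ (hcan.map_graft x y).symm)
      rw [LinearMap.mem_eqLocus.1 hx, LinearMap.mem_eqLocus.1 hy]
    · rintro _ _ ⟨x, hx, rfl⟩ ⟨y, hy, rfl⟩
      refine ⟨GrossmanLarson.Plus.star x y, ?_, rfl⟩
      refine (hι'.map_star x y).trans (Eq.trans ?_ (hcan.map_star x y).symm)
      rw [LinearMap.mem_eqLocus.1 hx, LinearMap.mem_eqLocus.1 hy]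
  · refine (RotaBaxter.forestHom_prod θ (FreeRB.op D θ) FreeRB.of n _).trans ?_
    simp only [RotaBaxter.treeHom_single, hleaf]
  · refine (RotaBaxter.forestHom_prod θ (FreeRB.op D θ) FreeRB.of n _).trans ?_
    -- With equal factors all the summands over permutations coincide.
    rw [Finset.sum_const, Finset.card_univ, Fintype.card_perm, Fintype.card_fin]
    simp [RotaBaxter.treeHom, map_finsuppSum, hleaf]
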